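/- Definitions. A jumping finite automaton (JFA) is a tuple $M=(Q,\Sigma,R,s,F)$ with a finite state set $Q$, a finite alphabet $\Sigma$, a finite set $R$ of rules $py\to q$ with $p,q\in Q$, $y\in\Sigma^*$ and $|y|\le 1$, a start state $s\in Q$ and a set $F\subseteq Q$ of final states. For configurations in $\Sigma^*Q\Sigma^*$, write $vpw\curvearrowright v'qz'$ if there are a rule $py\to q$ in $R$ and a word $z\in\Sigma^*$ with $w=yz$ and $vz=v'z'$. The language of $M$ is $L(M)=\{uv : u,v\in\Sigma^*,\ usv\curvearrowright^* f \text{ for some } f\in F\}$. An algorithm (a deterministic multi-tape Turing machine) for a decision problem with a size parameter $\kappa$ runs in time $\mathcal{O}^*(2^{o(\kappa)})$ if there are a function $f$ with $f(k)=o(k)$ as $k\to\infty$ and a polynomial $p$ such that on every instance $x$ it halts after at most $2^{f(\kappa(x))}\cdot p(|x|)$ steps, where $|x|$ is the length of the encoding of $x$. The Exponential Time Hypothesis (ETH) is the hypothesis that no algorithm decides in time $\mathcal{O}^*(2^{o(n)})$ whether a given 3-CNF formula (a conjunction of $m$ clauses, each a disjunction of three literals) over $n$ variables is satisfiable. Theorem.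 Unless ETH fails, there is no algorithm that, for a given JFA $M$ with state set $Q$ and a given word $w$ over its alphabet, decides whether $w\in L(M)$ and runs in time $\mathcal{O}^*(2^{o(|Q|)})$. -/

import Mathlib

/-! ### Jumping finite automata -/

/-- A general finite machine `(Q, Σ, R, s, F)`: the triple `(p, y, q) ∈ rules` is the
rule `p y → q`. -/
structure GeneralFiniteMachine (Q A : Type) where
  rules : Set (Q × List A × Q)
  finite_rules : rules.Finite
  start : Q
  final : Set Q

namespace GeneralFiniteMachine

variable {Q A : Type}

/-- A finite machine: every label has length at most one (so `ε`-transitions are allowed). Read with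
the jumping relation below, such a machine is a jumping finite automaton (JFA). -/
def IsFiniteMachine (M : GeneralFiniteMachine Q A) : Prop :=
  ∀ r ∈ M.rules, r.2.1.length ≤ 1

/-- The jumping relation. The triple `(v, p, w)` is the configuration `v p w ∈ Σ* Q Σ*`; we have
`v p w ↷ v' q z'` iff there are a rule `p y → q` and a word `z` with `w = y z` and `v z = v' z'`. -/
def Jump (M : GeneralFiniteMachine Q A) (c d : List A × Q × List A) : Prop :=
  ∃ y z : List A, (c.2.1, y, d.2.1) ∈ M.rules ∧ c.2.2 = y ++ z ∧ c.1 ++ z = d.1 ++ d.2.2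

/-- The language accepted by `M` as a (general) jumping finite automaton. -/
def jumpLanguage (M : GeneralFiniteMachine Q A) : Language A :=
  {w | ∃ u v : List A, ∃ f ∈ M.final, w = u ++ v ∧
    Relation.ReflTransGen M.Jump (u, M.start, v) ([], f, [])}

end GeneralFiniteMachine

/-! ### Instances of the universal word problem for JFA -/

/-- An explicitly given pair of a JFA and a word: the states are `0, …, numStates - 1`, the letters
are `0, …, numLetters - 1`, the sets of final states and of rules are given as lists. The label of
a rule is a letter or (`none`) the empty word. -/
structure JFAWordInstance where
  numStates : ℕ
  numLetters : ℕ
  start : Fin numStates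
  final : List (Fin numStates)
  rules : List (Fin numStates × Option (Fin numLetters) × Fin numStates)
  word : List (Fin numLetters)

namespace JFAWordInstance

/-- The machine `M` of the instance, with state set `Q = Fin numStates`. -/
def machine (I : JFAWordInstance) : GeneralFiniteMachine (Fin I.numStates) (Fin I.numLetters) where
  rules := {r | ∃ t ∈ I.rules, r = (t.1, t.2.1.toList, t.2.2)}
  finite_rules := by
    refine (I.rules.finite_toSet.image fun t => (t.1, t.2.1.toList, t.2.2)).subset ?_
    rintro r ⟨t, ht, rfl⟩
    exact ⟨t, ht, rfl⟩
  start := I.start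
  final := {q | q ∈ I.final}

theorem machine_isFiniteMachine (I : JFAWordInstance) : I.machine.IsFiniteMachine := by
  rintro r ⟨t, -, rfl⟩
  cases t.2.1 <;> simp

/-- The question of the universal word problem: `w ∈ L(M)`. -/
def Accepts (I : JFAWordInstance) : Prop :=
  I.word ∈ I.machine.jumpLanguage

end JFAWordInstance

/-! ### 3SAT -/

/-- A literal over the variables `x_0, …, x_{n-1}`: `(i, true)` is `x_i`, `(i, false)` is `¬ x_i`. -/
abbrev SatLiteral (n : ℕ) : Type := Fin n × Bool

/-- A 3-CNF formula: `numVars` variables and a list of clauses, each a disjunction of three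
literals. -/
structure ThreeCNF where
  numVars : ℕ
  clauses : List (SatLiteral numVars × SatLiteral numVars × SatLiteral numVars)

/-- Some assignment makes a literal of every clause true. -/
def ThreeCNF.Satisfiable (φ : ThreeCNF) : Prop :=
  ∃ ξ : Fin φ.numVars → Bool, ∀ c ∈ φ.clauses,
    ξ c.1.1 = c.1.2 ∨ ξ c.2.1.1 = c.2.1.2 ∨ ξ c.2.2.1 = c.2.2.2

/-! ### Encodings as bit strings

Indices are written in unary. They are smaller than the number of variables, states or letters, so
the length of an encoding is polynomial in the numbers of variables and clauses, respectively of
states, letters, rules, final states and symbols of the word. -/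

/-- `k` is written as `1^k 0`. -/
def encodeUnary (k : ℕ) : List Bool :=
  List.replicate k true ++ [false]

/-- A list is written as `1 x₁ 1 x₂ … 1 xₖ 0`. -/
def encodeBlocks {α : Type} (enc : α → List Bool) (l : List α) : List Bool :=
  l.flatMap (fun x => true :: enc x) ++ [false]

def SatLiteral.encode {n : ℕ} (l : SatLiteral n) : List Bool :=
  encodeUnary l.1 ++ [l.2]

def ThreeCNF.encode (φ : ThreeCNF) : List Bool :=
  encodeUnary φ.numVars ++
    encodeBlocks (fun c => SatLiteral.encode c.1 ++ SatLiteral.encode c.2.1 ++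
      SatLiteral.encode c.2.2) φ.clauses

def JFAWordInstance.encode (I : JFAWordInstance) : List Bool :=
  encodeUnary I.numStates ++ encodeUnary I.numLetters ++ encodeUnary I.start ++
    encodeBlocks (fun q => encodeUnary q) I.final ++
    encodeBlocks (fun r => encodeUnary r.1 ++
      encodeBlocks (fun a => encodeUnary a) r.2.1.toList ++ encodeUnary r.2.2) I.rules ++
    encodeBlocks (fun a => encodeUnary a) I.word

/-! ### Subexponential time and the exponential time hypothesis -/

open Classical in
/-- The problem `P` on instances `x : α`, encoded by `enc` and with size parameter `κ x`, is decided
by an algorithm (a deterministic multi-stack Turing machine) in time `O*(2^{o(κ)})`: there are a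
machine, a function `f` with `f(n) = o(n)` and a polynomial `p` such that the machine, started on
`enc x`, halts with the truth value of `P x` as its output after at most
`2^{f(κ x)} · p(|enc x|)` steps. -/
def DecidableInSubexpTime {α : Type} (enc : α → List Bool) (κ : α → ℕ) (P : α → Prop) : Prop :=
  ∃ (T : Turing.TM2ComputableAux Bool Bool) (f : ℕ → ℝ) (p : Polynomial ℕ),
    f =o[Filter.atTop] (fun n : ℕ => (n : ℝ)) ∧
    ∀ x : α, ∃ t : ℕ,
      (t : ℝ) ≤ (2 : ℝ) ^ f (κ x) * (p.eval (enc x).length : ℕ) ∧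
      Nonempty (Turing.TM2OutputsInTime T.tm ((enc x).map T.inputAlphabet.symm)
        (some ([decide (P x)].map T.outputAlphabet.symm)) t)

/-- The exponential time hypothesis: no algorithm solves 3SAT with `n` variables and `m` clauses in
time `O*(2^{o(n)})`. -/
def ExponentialTimeHypothesis : Prop :=
  ¬ DecidableInSubexpTime ThreeCNF.encode ThreeCNF.numVars ThreeCNF.Satisfiable

/-! A jump deletes the letter it reads and lets the head resume anywhere. Hence a JFA accepts a word
exactly when some ordinary run from the start to a final state spells a permutation of it
(`mem_jumpLanguage_iff`): the order of the letters is irrelevant, only their multiplicities count.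

This suffices to encode 3SAT. For n variables take a chain of hubs 0, …, n and, between hubs i and i
+ 1, two parallel states for the two literals of the i-th variable, linked by ε-rules. The letters
are the clauses, and the state of a literal has a loop for each clause containing it. A run along
the chain is an assignment together with a list of clauses read at true literals. The word contains
each clause once, so it is accepted iff some assignment satisfies every clause
(`accepts_toJFA_iff`). The clauses affect only the alphabet, the rules and the word; there are 3n +
1 states whatever the number of clauses, so o(|Q|) is o(n).

Since time is measured on concrete machines, the reduction is also implemented. It is a program in a
small stack language with a cost semantics `Exec`; `Exec.reachesIn` compiles such programs to Turing
machines and `outputs_comp` chains one with a decider. `exec_reduction` gives a quadratic time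
bound, and `DecidableInSubexpTime.of_reduction` transfers the subexponential bound. -/

/-! ### Paths of a finite machine and the jumping language -/

namespace GeneralFiniteMachine

variable {Q A : Type}

/-- `M.Path p l q`: some run of `M`, read as an ordinary automaton, leads from `p` to `q` and
reads `l`. -/
inductive Path (M : GeneralFiniteMachine Q A) : Q → List A → Q → Prop
  | nil (p : Q) : Path M p [] p
  | cons {p q f : Q} {y l : List A} : (p, y, q) ∈ M.rules → Path M q l f → Path M p (y ++ l) f

/-- Each jump removes its label from the tape and leaves the remaining word unchanged, whatever the
new head position, so the labels read add up to the tape as a multiset. -/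
theorem exists_path_of_jumps {M : GeneralFiniteMachine Q A} {c : List A × Q × List A} {f : Q}
    (h : Relation.ReflTransGen M.Jump c ([], f, [])) :
    ∃ l, M.Path c.2.1 l f ∧ l.Perm (c.1 ++ c.2.2) := by
  induction h using Relation.ReflTransGen.head_induction_on with
  | refl => exact ⟨[], .nil f, .refl _⟩
  | head h _ ih =>
    obtain ⟨y, z, hr, hw, hz⟩ := h
    obtain ⟨l, hl, hp⟩ := ih
    refine ⟨y ++ l, .cons hr hl, ?_⟩
    rw [hw, ← List.append_assoc]
    refine (hp.append_left y).trans ?_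
    rw [← hz, ← List.append_assoc]
    exact List.perm_append_comm.append_right z

/-- The head can always be placed in front of an occurrence of the next letter. Labels of length at
most one are essential: a longer label would have to occur as a factor of the remaining word. -/
theorem exists_jumps_of_path {M : GeneralFiniteMachine Q A} (hM : M.IsFiniteMachine) {p f : Q}
    {l : List A} (h : M.Path p l f) : ∀ w : List A, w.Perm l →
      ∃ u v, w = u ++ v ∧ Relation.ReflTransGen M.Jump (u, p, v) ([], f, []) := by
  induction h with
  | nil p =>
    intro w hw
    exact ⟨[], [], by simpa using hw, .refl⟩
  | @cons p q f y l hr _ ih =>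
    intro w hw
    have hy := hM _ hr
    match y, hy with
    | [], _ =>
      obtain ⟨u, v, rfl, h⟩ := ih w hw
      exact ⟨u, v, rfl, .head (b := (u, q, v)) ⟨[], v, hr, rfl, rfl⟩ h⟩
    | [a], _ =>
      have ha : a ∈ w := hw.symm.subset (by simp)
      obtain ⟨w₁, w₂, rfl⟩ := List.append_of_mem ha
      have hw' : (w₁ ++ w₂).Perm l := by
        have := (List.perm_middle (a := a) (l₁ := w₁) (l₂ := w₂)).symm.trans hw
        exact (List.perm_cons a).1 this
      obtain ⟨u, v, huv, h⟩ := ih _ hw'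
      exact ⟨w₁, a :: w₂, rfl, .head ⟨[a], w₂, hr, rfl, huv⟩ h⟩

theorem mem_jumpLanguage_iff {M : GeneralFiniteMachine Q A} (hM : M.IsFiniteMachine)
    {w : List A} :
    w ∈ M.jumpLanguage ↔ ∃ f ∈ M.final, ∃ l, M.Path M.start l f ∧ l.Perm w := by
  constructor
  · rintro ⟨u, v, f, hf, rfl, h⟩
    exact ⟨f, hf, exists_path_of_jumps h⟩
  · rintro ⟨f, hf, l, hl, hp⟩
    obtain ⟨u, v, huv, h⟩ := exists_jumps_of_path hM hl w hp.symm
    exact ⟨u, v, f, hf, huv, h⟩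

theorem Path.append_loops {M : GeneralFiniteMachine Q A} {p f : Q} {l : List A}
    (h : M.Path p l f) (a : List A) (ha : ∀ x ∈ a, (p, [x], p) ∈ M.rules) :
    M.Path p (a ++ l) f := by
  induction a with
  | nil => exact h
  | cons x a ih =>
    exact .cons (y := [x]) (ha x (by simp)) (ih fun z hz => ha z (by simp [hz]))

end GeneralFiniteMachine

/-! ### The reduction from 3SAT -/

namespace ThreeCNF

/-- The state in which a truth value for the variable `x_i` is chosen (for `i = n`: the final
state). -/
def hub {n : ℕ} (i : ℕ) (hi : i ≤ n) : Fin (3 * n + 1) := ⟨3 * i, by omega⟩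

/-- The number of the state entered when the literal `(k, b)` is made true. -/
def litIndex (k : ℕ) (b : Bool) : ℕ := 3 * k + cond b 1 2

theorem litIndex_lt {n : ℕ} (l : SatLiteral n) : litIndex l.1 l.2 < 3 * n + 1 := by
  have := l.1.2
  unfold litIndex
  cases l.2 <;> simp only [cond] <;> omega

/-- The state entered when the literal `l` is made true. -/
def litState {n : ℕ} (l : SatLiteral n) : Fin (3 * n + 1) := ⟨litIndex l.1 l.2, litIndex_lt l⟩

/-- The literals of a clause. -/
def lits {n : ℕ} (c : SatLiteral n × SatLiteral n × SatLiteral n) : List (SatLiteral n) :=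
  [c.1, c.2.1, c.2.2]

/-- The rules that read the letter of a clause in the states of its literals. -/
def loopRules {n m : ℕ} (c : SatLiteral n × SatLiteral n × SatLiteral n) (j : Fin m) :
    List (Fin (3 * n + 1) × Option (Fin m) × Fin (3 * n + 1)) :=
  (lits c).map fun l => (litState l, some j, litState l)

/-- The rules that choose a value of the variable `x_i`. -/
def choiceRules {n : ℕ} (m : ℕ) (i : Fin n) :
    List (Fin (3 * n + 1) × Option (Fin m) × Fin (3 * n + 1)) :=
  [(hub i i.2.le, none, litState (i, true)), (litState (i, true), none, hub (i + 1) i.2),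
    (hub i i.2.le, none, litState (i, false)), (litState (i, false), none, hub (i + 1) i.2)]

/-- The rules of the machine to which a formula is reduced. -/
def jfaRules (φ : ThreeCNF) : List (Fin (3 * φ.numVars + 1) × Option (Fin φ.clauses.length) ×
    Fin (3 * φ.numVars + 1)) :=
  (List.finRange φ.clauses.length).flatMap (fun j => loopRules (φ.clauses.get j) j) ++
    (List.finRange φ.numVars).reverse.flatMap (choiceRules φ.clauses.length)

/-- The instance of the universal word problem for JFA to which a formula is reduced. -/
def toJFA (φ : ThreeCNF) : JFAWordInstance where
  numStates := 3 * φ.numVars + 1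
  numLetters := φ.clauses.length
  start := hub 0 (Nat.zero_le _)
  final := [hub φ.numVars le_rfl]
  rules := φ.jfaRules
  word := List.finRange φ.clauses.length

/-- The machine of `φ.toJFA`, with its state set and alphabet made explicit. -/
def jfa (φ : ThreeCNF) :
    GeneralFiniteMachine (Fin (3 * φ.numVars + 1)) (Fin φ.clauses.length) :=
  φ.toJFA.machine

variable {φ : ThreeCNF}

theorem mem_rules_jfa {p q : Fin (3 * φ.numVars + 1)} {y : List (Fin φ.clauses.length)} :
    (p, y, q) ∈ φ.jfa.rules ↔
      (∃ j, ∃ l ∈ lits (φ.clauses.get j), p = litState l ∧ q = litState l ∧ y = [j]) ∨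
      (∃ (i : Fin φ.numVars) (b : Bool), y = [] ∧
        (p = hub i i.2.le ∧ q = litState (i, b) ∨
          p = litState (i, b) ∧ q = hub (i + 1) i.2)) := by
  change (∃ t ∈ φ.jfaRules, (p, y, q) = (t.1, t.2.1.toList, t.2.2)) ↔ _
  constructor
  · rintro ⟨⟨t₁, t₂, t₃⟩, ht, h⟩
    obtain ⟨rfl, rfl, rfl⟩ : p = t₁ ∧ y = t₂.toList ∧ q = t₃ := by
      simpa using h
    simp only [jfaRules, List.mem_append, List.mem_flatMap] at ht
    rcases ht with ⟨j, -, ht⟩ | ⟨i, -, ht⟩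
    · simp only [loopRules, List.mem_map, Prod.mk.injEq] at ht
      obtain ⟨l, hl, rfl, rfl, rfl⟩ := ht
      exact .inl ⟨j, l, hl, rfl, rfl, rfl⟩
    · simp only [choiceRules, List.mem_cons, List.not_mem_nil, or_false, Prod.mk.injEq] at ht
      rcases ht with ⟨rfl, rfl, rfl⟩ | ⟨rfl, rfl, rfl⟩ | ⟨rfl, rfl, rfl⟩ | ⟨rfl, rfl, rfl⟩
      · exact .inr ⟨i, true, rfl, .inl ⟨rfl, rfl⟩⟩
      · exact .inr ⟨i, true, rfl, .inr ⟨rfl, rfl⟩⟩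
      · exact .inr ⟨i, false, rfl, .inl ⟨rfl, rfl⟩⟩
      · exact .inr ⟨i, false, rfl, .inr ⟨rfl, rfl⟩⟩
  · rintro (⟨j, l, hl, rfl, rfl, rfl⟩ | ⟨i, b, rfl, h⟩)
    · exact ⟨(litState l, some j, litState l), List.mem_append_left _
        (List.mem_flatMap.2 ⟨j, List.mem_finRange j, List.mem_map.2 ⟨l, hl, rfl⟩⟩), rfl⟩
    · refine ⟨(p, none, q), List.mem_append_right _ (List.mem_flatMap.2 ⟨i, by simp, ?_⟩), rfl⟩
      rcases h with ⟨rfl, rfl⟩ | ⟨rfl, rfl⟩ <;> cases b <;> simp [choiceRules]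

/-- Hubs are 0 modulo 3, states of literals are 1 or 2. -/
theorem litState_ne_hub {n i : ℕ} (hi : i ≤ n) (l : SatLiteral n) : litState l ≠ hub i hi := by
  intro h
  have h := congrArg Fin.val h
  simp only [litState, hub, litIndex] at h
  cases h' : l.2 <;> rw [h'] at h <;> simp only [cond] at h <;> omega

theorem litState_injective {n : ℕ} : Function.Injective (litState (n := n)) := by
  rintro ⟨i, b⟩ ⟨i', b'⟩ h
  have h := congrArg Fin.val h
  simp only [litState, litIndex] at h
  have : b = b' := by cases b <;> cases b' <;> simp at h ⊢ <;> omega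
  subst this
  have : i = i' := by ext; omega
  rw [this]

/-- Along a run to the final state, the states of literals visited define an assignment that
satisfies all the clauses read. -/
theorem exists_assignment_of_path {p f : Fin (3 * φ.numVars + 1)}
    {l : List (Fin φ.clauses.length)} (h : φ.jfa.Path p l f)
    (hf : f = hub φ.numVars le_rfl) :
    ∃ ξ : Fin φ.numVars → Bool, (∀ x, p = litState x → ξ x.1 = x.2) ∧
      ∀ j ∈ l, ∃ x ∈ lits (φ.clauses.get j), ξ x.1 = x.2 ∧ p.1 ≤ 3 * x.1 + 2 := by
  -- The assignment is built backwards from the end of the run. The bound on the state number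
  -- records that the clauses still to be read are satisfied by variables not yet left behind.
  induction h with
  | nil p =>
    subst hf
    exact ⟨fun _ => true, fun x hx => absurd hx.symm (litState_ne_hub _ x), by simp⟩
  | @cons p q f y l hr _ ih =>
    obtain ⟨ξ, hq, hl⟩ := ih hf
    rcases mem_rules_jfa.1 hr with
      ⟨j, x, hx, rfl, rfl, rfl⟩ | ⟨i, b, rfl, ⟨rfl, rfl⟩ | ⟨rfl, rfl⟩⟩
    · refine ⟨ξ, hq, fun j' hj' => ?_⟩
      rcases List.mem_cons.1 (by simpa using hj' : j' ∈ j :: l) with rfl | hj'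
      · refine ⟨x, hx, hq x rfl, ?_⟩
        simp only [litState, litIndex]
        cases x.2 <;> simp
      · exact hl j' hj'
    · refine ⟨ξ, fun x hx => absurd hx.symm (litState_ne_hub _ x), fun j' hj' => ?_⟩
      obtain ⟨x, hx, hv, hle⟩ := hl j' hj'
      refine ⟨x, hx, hv, le_trans ?_ hle⟩
      simp only [hub, litState, litIndex]
      omega
    · refine ⟨Function.update ξ i b, fun x hx => ?_, fun j' hj' => ?_⟩
      · obtain rfl := litState_injective hx
        simp
      · obtain ⟨x, hx, hv, hle⟩ := hl j' hj'
        simp only [hub] at hle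
        -- After hub i + 1 only variables of index at least i + 1 serve as witnesses, so fixing the
        -- value of variable i spoils none of them.
        have hne : x.1 ≠ i := fun h => by rw [h] at hle; omega
        refine ⟨x, hx, by rw [Function.update_of_ne hne, hv], ?_⟩
        simp only [litState, litIndex]
        cases b <;> simp <;> omega

/-- A choice of a true literal in every clause defines a run from every hub. -/
theorem exists_path_of_assignment (ξ : Fin φ.numVars → Bool)
    (v : Fin φ.clauses.length → Fin φ.numVars)
    (hv : ∀ j, (v j, ξ (v j)) ∈ lits (φ.clauses.get j)) :
    ∀ (d i : ℕ) (hi : i + d = φ.numVars), ∃ l,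
      φ.jfa.Path (hub i (by omega)) l (hub φ.numVars le_rfl) ∧
      l.Perm ((List.finRange φ.clauses.length).filter fun j => decide (i ≤ v j)) := by
  intro d
  induction d with
  | zero =>
    intro i hi
    obtain rfl : i = φ.numVars := by omega
    refine ⟨[], .nil _, ?_⟩
    rw [List.filter_eq_nil_iff.2]
    intro j _
    simp
  | succ d ih =>
    intro i hi
    obtain ⟨l, hl, hp⟩ := ih (i + 1) (by omega)
    have hin : i < φ.numVars := by omega
    let i' : Fin φ.numVars := ⟨i, hin⟩
    -- The clauses assigned to variable i are all read by loops at its true literal; the rest of the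
    -- run reads those assigned to later variables.
    let a := (List.finRange φ.clauses.length).filter fun j => decide (v j = i')
    have h₁ : φ.jfa.Path (litState (i', ξ i')) l (hub φ.numVars le_rfl) :=
      .cons (y := []) (mem_rules_jfa.2 (.inr ⟨i', ξ i', rfl, .inr ⟨rfl, rfl⟩⟩)) hl
    have h₂ := h₁.append_loops a fun j hj => by
      have hj : v j = i' := by simpa [a] using hj
      exact mem_rules_jfa.2 (.inl ⟨j, (i', ξ i'), hj ▸ hv j, rfl, rfl, rfl⟩)
    refine ⟨a ++ l, .cons (y := [])
      (mem_rules_jfa.2 (.inr ⟨i', ξ i', rfl, .inl ⟨rfl, rfl⟩⟩)) h₂, ?_⟩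
    refine (hp.append_left a).trans ?_
    refine List.Perm.trans (.of_eq ?_) (List.filter_append_perm (fun j => decide (v j = i')) _)
    rw [List.filter_filter, List.filter_filter]
    congr 1 <;> apply List.filter_congr <;> intro j _ <;>
      simp only [i', Fin.ext_iff, ← Bool.decide_and, ← decide_not, decide_eq_decide] <;> omega

theorem accepts_toJFA_iff : φ.toJFA.Accepts ↔ φ.Satisfiable := by
  have hsat : φ.Satisfiable ↔ ∃ ξ : Fin φ.numVars → Bool, ∀ j : Fin φ.clauses.length,
      ∃ x ∈ lits (φ.clauses.get j), ξ x.1 = x.2 := by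
    refine exists_congr fun ξ => ?_
    simp only [List.forall_mem_iff_get, lits, List.mem_cons, List.not_mem_nil, or_false,
      exists_eq_or_imp, exists_eq_left]
  rw [hsat, JFAWordInstance.Accepts,
    GeneralFiniteMachine.mem_jumpLanguage_iff φ.toJFA.machine_isFiniteMachine]
  change (∃ f ∈ [hub φ.numVars le_rfl], ∃ l, φ.jfa.Path (hub 0 (Nat.zero_le _)) l f ∧
    l.Perm (List.finRange φ.clauses.length)) ↔ _
  constructor
  · rintro ⟨f, hf, l, hl, hp⟩
    obtain ⟨ξ, -, h⟩ := exists_assignment_of_path hl (List.mem_singleton.1 hf)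
    refine ⟨ξ, fun j => ?_⟩
    obtain ⟨x, hx, hxv, -⟩ := h j (hp.symm.subset (List.mem_finRange j))
    exact ⟨x, hx, hxv⟩
  · rintro ⟨ξ, h⟩
    choose x hx hxv using h
    obtain ⟨l, hl, hp⟩ := exists_path_of_assignment ξ (fun j => (x j).1)
      (fun j => by rw [hxv]; exact hx j) φ.numVars 0 (by omega)
    -- From hub 0 the filter `0 ≤ v j` keeps every clause.
    exact ⟨_, List.mem_singleton.2 rfl, l, hl, by simpa using hp⟩

end ThreeCNF

/-! ### Programs on stacks of bits -/

/-- Programs that work on stacks of bits, named by `K`, and that write to an output stack. -/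
inductive StackProg (K : Type) : Type
  /-- Push the bits of a list on a stack, one after the other. -/
  | push (k : K) (bs : List Bool)
  /-- Write a list in front of the output. -/
  | emit (bs : List Bool)
  /-- Pop all bits of a stack and push them on the output stack. -/
  | flush (k : K)
  | seq (p q : StackProg K)
  /-- Pop a bit and branch. -/
  | ite (k : K) (p q : StackProg K)
  /-- Pop a bit; if it is `true`, run the body and repeat. -/
  | loop (k : K) (p : StackProg K)

namespace StackProg

infixr:60 ";;" => StackProg.seq

variable {K : Type} [DecidableEq K]

/-- `Exec p s o s' o' t`: started with the stacks `s` and the output `o`, the program `p` ends with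
the stacks `s'` and the output `o'`, in time at most `t`. -/
inductive Exec : StackProg K → (K → List Bool) → List Bool → (K → List Bool) → List Bool → ℕ → Prop
  | push (k bs s o) : Exec (push k bs) s o (Function.update s k (bs.reverse ++ s k)) o (bs.length + 1)
  | emit (bs s o) : Exec (emit bs) s o s (bs ++ o) (bs.length + 1)
  | flush (k s o) :
      Exec (flush k) s o (Function.update s k []) ((s k).reverse ++ o) ((s k).length + 1)
  | seq {p q s o s₁ o₁ s₂ o₂ t₁ t₂} : Exec p s o s₁ o₁ t₁ → Exec q s₁ o₁ s₂ o₂ t₂ →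
      Exec (seq p q) s o s₂ o₂ (t₁ + t₂)
  | ite_true {k p q s o s' o' t l} : s k = true :: l → Exec p (Function.update s k l) o s' o' t →
      Exec (ite k p q) s o s' o' (t + 1)
  | ite_false {k p q s o s' o' t l} : s k = false :: l →
      Exec q (Function.update s k l) o s' o' t → Exec (ite k p q) s o s' o' (t + 1)
  | loop_exit {k p s o} : (s k).head? ≠ some true →
      Exec (loop k p) s o (Function.update s k (s k).tail) o 1
  | loop_step {k p s o s₁ o₁ s₂ o₂ t₁ t₂ l} : s k = true :: l →
      Exec p (Function.update s k l) o s₁ o₁ t₁ → Exec (loop k p) s₁ o₁ s₂ o₂ t₂ →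
      Exec (loop k p) s o s₂ o₂ (t₁ + t₂ + 1)
  | weaken {p s o s' o' t t'} : t ≤ t' → Exec p s o s' o' t → Exec p s o s' o' t'

theorem Exec.length_output_le {p : StackProg K} {s o s' o' t} (h : Exec p s o s' o' t) :
    o'.length ≤ o.length + t := by
  induction h <;> grind

/-- Each bit written is paid for by the cost model. This later bounds the accumulated rules and word
by the running time, without computing their lengths. -/
theorem Exec.length_le {p : StackProg K} {s o s' o' t} (h : Exec p s o s' o' t) (k : K) :
    (s' k).length + o'.length ≤ (s k).length + o.length + t := by
  induction h <;> grind

theorem Exec.congr {p : StackProg K} {s o s' o' s'' o'' t t'} (h : Exec p s o s' o' t)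
    (hs : s' = s'') (ho : o' = o'') (ht : t ≤ t') : Exec p s o s'' o'' t' := by
  subst hs ho
  exact .weaken ht h

/-- A loop whose body takes the stacks and the output through given sequences. -/
theorem exec_loop_iterate {k : K} {p : StackProg K} {t : ℕ} (j : ℕ) (F : ℕ → K → List Bool)
    (O : ℕ → List Bool)
    (hF : ∀ i < j, ∃ l, F i k = true :: l ∧
      Exec p (Function.update (F i) k l) (O i) (F (i + 1)) (O (i + 1)) t)
    (hj : (F j k).head? ≠ some true) :
    Exec (loop k p) (F 0) (O 0) (Function.update (F j) k (F j k).tail) (O j)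
      (j * (t + 1) + 1) := by
  induction j generalizing F O with
  | zero => exact (Exec.loop_exit hj).congr rfl rfl (by omega)
  | succ j ih =>
    obtain ⟨l, hl, h⟩ := hF 0 (by omega)
    have := ih (fun i => F (i + 1)) (fun i => O (i + 1)) (fun i hi => hF (i + 1) (by omega)) hj
    exact (Exec.loop_step hl h this).congr rfl rfl (by ring_nf; omega)

/-- Drain a counter, pushing `d` times `true` on another stack for each of its elements. -/
theorem exec_loop_push {k k' : K} (hk : k ≠ k') (d : ℕ) {s : K → List Bool} {j : ℕ} {l : List Bool}
    (hs : s k = List.replicate j true ++ l) (hl : l.head? ≠ some true) (o : List Bool) :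
    Exec (loop k (push k' (List.replicate d true))) s o
      (Function.update (Function.update s k l.tail) k' (List.replicate (d * j) true ++ s k')) o
      (j * (d + 2) + 1) := by
  have h := exec_loop_iterate (k := k) (p := push k' (List.replicate d true)) (t := d + 1) j
    (fun i => Function.update (Function.update s k (List.replicate (j - i) true ++ l)) k'
      (List.replicate (d * i) true ++ s k')) (fun _ => o) ?_ (by simp [hk, hl])
  · simp only [Nat.sub_zero, Nat.mul_zero, List.replicate_zero, List.nil_append] at h
    rw [← hs, Function.update_eq_self, Function.update_eq_self] at h
    refine h.congr ?_ rfl le_rfl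
    funext x
    by_cases h₁ : x = k <;> by_cases h₂ : x = k' <;> simp_all
  · intro i hi
    refine ⟨List.replicate (j - (i + 1)) true ++ l, ?_, ?_⟩
    · rw [Function.update_of_ne hk, Function.update_self, show j - i = j - (i + 1) + 1 by omega,
        List.replicate_succ, List.cons_append]
    · refine (Exec.push _ _ _ _).congr ?_ rfl (by simp)
      funext x
      by_cases h₁ : x = k <;> by_cases h₂ : x = k' <;>
        simp_all [Function.update_apply, ← List.append_assoc, Nat.mul_succ,
          add_comm]

/-- Drain a counter, writing `d` times `true` to the output for each of its elements. -/
theorem exec_loop_emit {k : K} (d : ℕ) {s : K → List Bool} {j : ℕ}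
    (hs : s k = List.replicate j true) (o : List Bool) :
    Exec (loop k (emit (List.replicate d true))) s o
      (Function.update s k []) (List.replicate (d * j) true ++ o) (j * (d + 2) + 1) := by
  have h := exec_loop_iterate (k := k) (p := emit (List.replicate d true)) (t := d + 1) j
    (fun i => Function.update s k (List.replicate (j - i) true))
    (fun i => List.replicate (d * i) true ++ o) ?_ (by simp)
  · simpa [← hs] using h
  · intro i hi
    refine ⟨List.replicate (j - (i + 1)) true, ?_, ?_⟩
    · rw [Function.update_self, show j - i = j - (i + 1) + 1 by omega, List.replicate_succ]
    · refine (Exec.emit _ _ _).congr (by simp) ?_ (by simp)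
      simp [← List.append_assoc, Nat.mul_succ, add_comm]

/-- Push `d` times `true` for each element of a counter, keeping the counter by means of an
empty stack. -/
def copy (src aux dst : K) (d : ℕ) : StackProg K :=
  loop src (push aux [true] ;; push dst (List.replicate d true)) ;; loop aux (push src [true])

theorem exec_copy {src aux dst : K} (h₁ : src ≠ aux) (h₂ : src ≠ dst) (h₃ : aux ≠ dst) (d : ℕ)
    {s : K → List Bool} {j : ℕ} (hs : s src = List.replicate j true) (ha : s aux = [])
    (o : List Bool) :
    Exec (copy src aux dst d) s o
      (Function.update s dst (List.replicate (d * j) true ++ s dst)) o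
      (j * (d + 7) + 2) := by
  -- The stacks after i rounds of the first loop, which moves `src` to `aux`; the second loop moves
  -- it back.
  let F : ℕ → K → List Bool := fun i => Function.update (Function.update (Function.update s src
    (List.replicate (j - i) true)) aux (List.replicate i true)) dst
    (List.replicate (d * i) true ++ s dst)
  have h := exec_loop_iterate (k := src)
    (p := push aux [true] ;; push dst (List.replicate d true)) (t := d + 3) j F (fun _ => o) ?_
    (by simp [F, h₁, h₂])
  · have hF : F 0 = s := by
      funext x
      by_cases x = src <;> by_cases x = aux <;> by_cases x = dst <;>
        simp_all [F]
    rw [hF] at h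
    refine (h.seq (exec_loop_push h₁.symm 1 (j := j) (l := []) (by simp [F, h₁.symm, h₃])
      (by simp) o)).congr ?_ rfl (by ring_nf; omega)
    funext x
    by_cases x = src <;> by_cases x = aux <;> by_cases x = dst <;>
      simp_all [F, Function.update_apply]
  · intro i hi
    refine ⟨List.replicate (j - (i + 1)) true, ?_, ?_⟩
    · simp only [F]
      rw [Function.update_of_ne h₂, Function.update_of_ne h₁, Function.update_self,
        show j - i = j - (i + 1) + 1 by omega, List.replicate_succ]
    · refine ((Exec.push _ _ _ _).seq (Exec.push _ _ _ _)).congr ?_ rfl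
        (by simp only [List.length_replicate, List.length_singleton]; omega)
      funext x
      by_cases x = src <;> by_cases x = aux <;> by_cases x = dst <;>
        simp_all [F, Function.update_apply, ← List.append_assoc,
          Nat.mul_succ, add_comm, List.replicate_succ]

/-- The control points of a program. -/
@[reducible] def Label : StackProg K → Type
  | push _ _ => Unit
  | emit _ => Unit
  | flush _ => Unit
  | seq p q => p.Label ⊕ q.Label
  | ite _ p q => Option (p.Label ⊕ q.Label)
  | loop _ p => Option p.Label

instance fintypeLabel : (p : StackProg K) → Fintype p.Label
  | push _ _ => inferInstanceAs (Fintype Unit)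
  | emit _ => inferInstanceAs (Fintype Unit)
  | flush _ => inferInstanceAs (Fintype Unit)
  | seq p q => letI := fintypeLabel p; letI := fintypeLabel q
    inferInstanceAs (Fintype (p.Label ⊕ q.Label))
  | ite _ p q => letI := fintypeLabel p; letI := fintypeLabel q
    inferInstanceAs (Fintype (Option (p.Label ⊕ q.Label)))
  | loop _ p => letI := fintypeLabel p
    inferInstanceAs (Fintype (Option p.Label))

/-- The control point at which a program starts. -/
def entry : (p : StackProg K) → p.Label
  | push _ _ => ()
  | emit _ => ()
  | flush _ => ()
  | seq p _ => .inl p.entry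
  | ite _ _ _ => none
  | loop _ _ => none

end StackProg

/-! ### Programs as Turing machines -/

namespace Turing.TM2

variable {K : Type} {Γ : K → Type} {Λ σ : Type}

/-- Push the elements of a list on a stack, one after the other. -/
def Stmt.pushAll (k : K) (bs : List (Γ k)) (q : Stmt Γ Λ σ) : Stmt Γ Λ σ :=
  bs.foldr (fun b q => .push k (fun _ => b) q) q

theorem stepAux_pushAll [DecidableEq K] (k : K) (bs : List (Γ k)) (q : Stmt Γ Λ σ) (v : σ)
    (S : ∀ k, List (Γ k)) :
    stepAux (Stmt.pushAll k bs q) v S =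
      stepAux q v (Function.update S k (bs.reverse ++ S k)) := by
  induction bs generalizing S with
  | nil => simp [Stmt.pushAll]
  | cons b bs ih =>
    change stepAux (Stmt.pushAll k bs q) v _ = _
    rw [ih]
    simp

end Turing.TM2

namespace StackProg

open Turing

variable {K : Type} [DecidableEq K] (T : FinTM2) (e : Bool → T.Γ T.k₀)

/-- The stack alphabets of a machine that runs a program before the machine `T`. -/
abbrev stackAlphabet (K : Type) (T : FinTM2) : K ⊕ T.K → Type
  | .inl _ => Bool
  | .inr k => T.Γ k

/-- Statements of a machine that runs a program before the machine `T`; the internal state holds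
the bit popped last and the internal state of `T`. -/
abbrev CompStmt (K : Type) (T : FinTM2) (Λ : Type) : Type :=
  TM2.Stmt (stackAlphabet K T) Λ (Option Bool × T.σ)

/-- Pop a bit and jump to a label that depends on it. -/
def popGoto {Λ : Type} (k : K) (onTrue onFalse onNone : CompStmt K T Λ) : CompStmt K T Λ :=
  .pop (Sum.inl k) (fun v (b : Option Bool) => (b, v.2))
    (.branch (fun v => v.1 == some true) (.load (fun v => (none, v.2)) onTrue)
      (.branch (fun v => v.1 == some false) (.load (fun v => (none, v.2)) onFalse)
        onNone))

/-- The statement at a control point of a program; `lab` places the control points in the set of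
labels of the whole machine, and the program continues at the label `exit`. -/
def code {Λ : Type} : (p : StackProg K) → (lab : p.Label → Λ) → (exit : Λ) → p.Label →
    CompStmt K T Λ
  | push k bs, _, exit, _ =>
    TM2.Stmt.pushAll (Γ := stackAlphabet K T) (Sum.inl k) bs (.goto fun _ => exit)
  | emit bs, _, exit, _ =>
    TM2.Stmt.pushAll (Γ := stackAlphabet K T) (Sum.inr T.k₀) (bs.map e).reverse
      (.goto fun _ => exit)
  | flush k, lab, exit, _ =>
    popGoto T k
      (.push (Sum.inr T.k₀) (fun _ => e true) (.goto fun _ => lab ()))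
      (.push (Sum.inr T.k₀) (fun _ => e false) (.goto fun _ => lab ()))
      (.goto fun _ => exit)
  | seq p q, lab, _, .inl l => code p (fun l => lab (.inl l)) (lab (.inr q.entry)) l
  | seq _ q, lab, exit, .inr l => code q (fun l => lab (.inr l)) exit l
  | ite k p q, lab, exit, none =>
    popGoto T k (.goto fun _ => lab (some (.inl p.entry)))
      (.goto fun _ => lab (some (.inr q.entry))) (.goto fun _ => exit)
  | ite _ p _, lab, exit, some (.inl l) => code p (fun l => lab (some (.inl l))) exit l
  | ite _ _ q, lab, exit, some (.inr l) => code q (fun l => lab (some (.inr l))) exit l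
  | loop k p, lab, exit, none =>
    popGoto T k (.goto fun _ => lab (some p.entry)) (.goto fun _ => exit) (.goto fun _ => exit)
  | loop _ p, lab, _, some l => code p (fun l => lab (some l)) (lab none) l

/-- The stacks of the whole machine while a program runs. -/
def joinStacks (s : K → List Bool) (S : ∀ k, List (T.Γ k)) : ∀ k, List (stackAlphabet K T k)
  | .inl k => s k
  | .inr k => S k

/-- The input of `T`, on its input stack. -/
def inputStacks (o : List Bool) : ∀ k, List (T.Γ k) :=
  Function.update (fun _ => []) T.k₀ (o.map e)

theorem update_joinStacks_inl (s : K → List Bool) (S : ∀ k, List (T.Γ k)) (k : K) (l : List Bool) :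
    Function.update (joinStacks T s S) (Sum.inl k) l = joinStacks T (Function.update s k l) S := by
  funext k'
  rcases k' with k' | k'
  · by_cases h : k' = k
    · subst h
      simp [joinStacks]
    · rw [Function.update_of_ne (by simpa using h)]
      simp [joinStacks, h]
  · rw [Function.update_of_ne (by simp)]
    rfl

theorem update_joinStacks_inr (s : K → List Bool) (S : ∀ k, List (T.Γ k)) (k : T.K)
    (l : List (T.Γ k)) :
    Function.update (joinStacks T s S) (Sum.inr k) l = joinStacks T s (Function.update S k l) := by
  funext k'
  rcases k' with k' | k'
  · rw [Function.update_of_ne (by simp)]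
    rfl
  · by_cases h : k' = k
    · subst h
      simp [joinStacks]
    · rw [Function.update_of_ne (by simpa using h)]
      simp [joinStacks, h]

theorem update_inputStacks (o o' : List Bool) :
    Function.update (inputStacks T e o) T.k₀ (o'.map e) = inputStacks T e o' := by
  simp [inputStacks]

theorem inputStacks_self (o : List Bool) : inputStacks T e o T.k₀ = o.map e := by
  simp [inputStacks]

/-- The configuration of the whole machine while a program runs. -/
def progCfg {Λ : Type} (l : Λ) (s : K → List Bool) (o : List Bool) :
    TM2.Cfg (stackAlphabet K T) Λ (Option Bool × T.σ) :=
  ⟨some l, (none, T.initialState), joinStacks T s (inputStacks T e o)⟩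

/-- The bit register is `none` again after the branch, so between two steps a configuration is
determined by label and stacks alone. -/
theorem stepAux_popGoto {Λ : Type} (k : K) (a b c : CompStmt K T Λ) (v : T.σ)
    (s : K → List Bool) (S : ∀ k, List (T.Γ k)) :
    TM2.stepAux (popGoto T k a b c) (none, v) (joinStacks T s S) =
      TM2.stepAux (match (s k).head? with
        | some true => a
        | some false => b
        | none => c) (none, v) (joinStacks T (Function.update s k (s k).tail) S) := by
  simp only [popGoto, TM2.stepAux]
  have h : joinStacks T s S (Sum.inl k) = s k := rfl
  rw [h, update_joinStacks_inl]
  rcases s k with _ | ⟨_ | _, l⟩ <;> rfl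

/-- Reaching a configuration in at most `t` steps. -/
def ReachesIn {C : Type} (f : C → Option C) (a b : C) (t : ℕ) : Prop :=
  ∃ n ≤ t, (flip bind f)^[n] (some a) = some b

theorem ReachesIn.trans {C : Type} {f : C → Option C} {a b c : C} {t₁ t₂ : ℕ}
    (h₁ : ReachesIn f a b t₁) (h₂ : ReachesIn f b c t₂) : ReachesIn f a c (t₁ + t₂) := by
  obtain ⟨n₁, hn₁, h₁⟩ := h₁
  obtain ⟨n₂, hn₂, h₂⟩ := h₂
  refine ⟨n₂ + n₁, by omega, ?_⟩
  rw [Function.iterate_add_apply, h₁, h₂]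

theorem ReachesIn.mono {C : Type} {f : C → Option C} {a b : C} {t₁ t₂ : ℕ}
    (h : ReachesIn f a b t₁) (ht : t₁ ≤ t₂) : ReachesIn f a b t₂ :=
  h.imp fun _ hn => ⟨hn.1.trans ht, hn.2⟩

theorem ReachesIn.single {C : Type} {f : C → Option C} {a b : C} (h : f a = some b) :
    ReachesIn f a b 1 :=
  ⟨1, le_rfl, h⟩

theorem reachesIn_flush {Λ : Type} (m : Λ → CompStmt K T Λ) (k : K) (lab : Unit → Λ)
    (exit : Λ) (hm : m (lab ()) = code T e (flush k) lab exit ()) (l : List Bool) :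
    ∀ s o, s k = l → ReachesIn (TM2.step m) (progCfg T e (lab ()) s o)
      (progCfg T e exit (Function.update s k []) (l.reverse ++ o)) (l.length + 1) := by
  induction l with
  | nil =>
    intro s o hs
    refine .single ?_
    simp only [progCfg, TM2.step, hm, code]
    rw [stepAux_popGoto, hs]
    rfl
  | cons b l ih =>
    intro s o hs
    have h₁ : ReachesIn (TM2.step m) (progCfg T e (lab ()) s o)
        (progCfg T e (lab ()) (Function.update s k l) (b :: o)) 1 := by
      refine .single ?_
      simp only [progCfg, TM2.step, hm, code]
      rw [stepAux_popGoto, hs]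
      have h : ∀ s S, joinStacks (K := K) T s S (Sum.inr T.k₀) = S T.k₀ := fun _ _ => rfl
      cases b <;> simp only [List.head?_cons, List.tail_cons, TM2.stepAux] <;>
        rw [h, inputStacks_self, update_joinStacks_inr, ← List.map_cons (f := e), update_inputStacks]
    have h₂ := h₁.trans (ih (Function.update s k l) (b :: o) (by simp))
    rw [Function.update_idem] at h₂
    simpa [add_comm] using h₂

/-- A machine that contains the code of a program runs the program. -/
theorem Exec.reachesIn {p : StackProg K} {s o s' o' t} (h : Exec p s o s' o' t) {Λ : Type}
    (m : Λ → CompStmt K T Λ) (lab : p.Label → Λ) (exit : Λ)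
    (hm : ∀ l, m (lab l) = code T e p lab exit l) :
    ReachesIn (TM2.step m) (progCfg T e (lab p.entry) s o) (progCfg T e exit s' o') t := by
  -- The exit has to vary: the first part of a sequence exits to the entry of the second, and a loop
  -- body exits to the loop test.
  induction h generalizing exit with
  | push k bs s o =>
    -- The machine pushes the whole list in a single step; the larger cost in `Exec` is what makes
    -- lengths bounded by time.
    refine (ReachesIn.single ?_).mono (Nat.le_add_left 1 _)
    simp only [progCfg, TM2.step, hm, code]
    rw [TM2.stepAux_pushAll]
    simp only [TM2.stepAux]
    rw [update_joinStacks_inl]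
    rfl
  | emit bs s o =>
    refine (ReachesIn.single ?_).mono (Nat.le_add_left 1 _)
    simp only [progCfg, TM2.step, hm, code]
    rw [TM2.stepAux_pushAll, List.reverse_reverse]
    have h : ∀ s S, joinStacks (K := K) T s S (Sum.inr T.k₀) = S T.k₀ := fun _ _ => rfl
    rw [h, inputStacks_self, update_joinStacks_inr, ← List.map_append, update_inputStacks]
    rfl
  | flush k s o => exact reachesIn_flush T e m k lab exit (hm ()) _ s o rfl
  | @seq p q s o s₁ o₁ s₂ o₂ t₁ t₂ _ _ ih₁ ih₂ =>
    exact (ih₁ (fun l => lab (.inl l)) (lab (.inr q.entry)) fun l => hm (.inl l)).trans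
      (ih₂ (fun l => lab (.inr l)) exit fun l => hm (.inr l))
  | @ite_true k p q s o s' o' t l hs _ ih =>
    rw [add_comm]
    refine ReachesIn.trans (.single ?_)
      (ih (fun l => lab (some (.inl l))) exit fun l => hm (some (.inl l)))
    simp only [progCfg, TM2.step, hm, entry, code]
    rw [stepAux_popGoto, hs]
    rfl
  | @ite_false k p q s o s' o' t l hs _ ih =>
    rw [add_comm]
    refine ReachesIn.trans (.single ?_)
      (ih (fun l => lab (some (.inr l))) exit fun l => hm (some (.inr l)))
    simp only [progCfg, TM2.step, hm, entry, code]
    rw [stepAux_popGoto, hs]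
    rfl
  | @loop_exit k p s o hs =>
    refine .single ?_
    simp only [progCfg, TM2.step, hm, entry, code]
    rw [stepAux_popGoto]
    rcases h : s k with _ | ⟨_ | _, l⟩
    · rfl
    · rfl
    · simp [h] at hs
  | @loop_step k p s o s₁ o₁ s₂ o₂ t₁ t₂ l hs _ _ ih₁ ih₂ =>
    rw [add_comm]
    refine ReachesIn.trans (.single ?_)
      ((ih₁ (fun l => lab (some l)) (lab none) fun l => hm (some l)).trans (ih₂ lab exit hm))
    simp only [progCfg, TM2.step, hm, entry, code]
    rw [stepAux_popGoto, hs]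
    rfl
  | weaken ht _ ih => exact (ih lab exit hm).mono ht

/-! ### Running a machine after a program -/

/-- A statement of `T` as a statement of a machine with more stacks. -/
def liftStmt {Λ : Type} (lab : T.Λ → Λ) : TM2.Stmt T.Γ T.Λ T.σ → CompStmt K T Λ
  | .push k f q => .push (Sum.inr k) (fun v => f v.2) (liftStmt lab q)
  | .peek k f q => .peek (Sum.inr k) (fun v a => (v.1, f v.2 a)) (liftStmt lab q)
  | .pop k f q => .pop (Sum.inr k) (fun v a => (v.1, f v.2 a)) (liftStmt lab q)
  | .load f q => .load (fun v => (v.1, f v.2)) (liftStmt lab q)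
  | .branch f q₁ q₂ => .branch (fun v => f v.2) (liftStmt lab q₁) (liftStmt lab q₂)
  | .goto f => .goto fun v => lab (f v.2)
  | .halt => .halt

/-- A configuration of `T` as a configuration of the whole machine. -/
def liftCfg {Λ : Type} (lab : T.Λ → Λ) (c : TM2.Cfg T.Γ T.Λ T.σ) :
    TM2.Cfg (stackAlphabet K T) Λ (Option Bool × T.σ) :=
  ⟨c.l.map lab, (none, c.var), joinStacks T (fun _ => []) c.stk⟩

/-- A lifted statement touches neither the bit register nor the program's stacks, so `liftCfg`
intertwines the two machines. -/
theorem stepAux_liftStmt {Λ : Type} (lab : T.Λ → Λ) (q : TM2.Stmt T.Γ T.Λ T.σ) (v : T.σ)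
    (S : ∀ k, List (T.Γ k)) :
    TM2.stepAux (liftStmt T lab q) (none, v) (joinStacks (K := K) T (fun _ => []) S) =
      liftCfg T lab (TM2.stepAux q v S) := by
  have h : ∀ k, joinStacks (K := K) T (fun _ => []) S (Sum.inr k) = S k := fun _ => rfl
  induction q generalizing v S with
  | push k f q ih =>
    simp only [liftStmt, TM2.stepAux]
    rw [h, update_joinStacks_inr, ih]
    intro; rfl
  | peek k f q ih =>
    simp only [liftStmt, TM2.stepAux]
    rw [h, ih _ _ h]
  | pop k f q ih =>
    simp only [liftStmt, TM2.stepAux]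
    rw [h, update_joinStacks_inr, ih]
    intro; rfl
  | load f q ih => exact ih _ _ h
  | branch f q₁ q₂ ih₁ ih₂ =>
    simp only [liftStmt, TM2.stepAux]
    cases f v
    · exact ih₂ _ _ h
    · exact ih₁ _ _ h
  | goto f => rfl
  | halt => rfl

theorem step_liftCfg {Λ : Type} (m : Λ → CompStmt K T Λ) (lab : T.Λ → Λ)
    (hm : ∀ l, m (lab l) = liftStmt T lab (T.m l)) (c : TM2.Cfg T.Γ T.Λ T.σ) :
    TM2.step m (liftCfg T lab c) = (TM2.step T.m c).map (liftCfg T lab) := by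
  rcases c with ⟨_ | l, v, S⟩
  · rfl
  · simp only [liftCfg, Option.map_some, TM2.step, hm]
    rw [stepAux_liftStmt]
    rfl

theorem ReachesIn.lift {Λ : Type} {m : Λ → CompStmt K T Λ} {lab : T.Λ → Λ}
    (hm : ∀ l, m (lab l) = liftStmt T lab (T.m l)) {a b : TM2.Cfg T.Γ T.Λ T.σ} {t : ℕ}
    (h : ReachesIn (TM2.step T.m) a b t) :
    ReachesIn (TM2.step m) (liftCfg T lab a) (liftCfg T lab b) t := by
  obtain ⟨n, hn, h⟩ := h
  refine ⟨n, hn, ?_⟩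
  have key : ∀ x : Option (TM2.Cfg T.Γ T.Λ T.σ),
      flip bind (TM2.step m) (x.map (liftCfg T lab)) =
        (flip bind (TM2.step T.m) x).map (liftCfg T lab) := by
    rintro (_ | c)
    · rfl
    · exact step_liftCfg T m lab hm c
  have := (Function.Semiconj.iterate_right (f := Option.map (liftCfg T lab))
    (ga := flip bind (TM2.step T.m)) (gb := flip bind (TM2.step m)) (fun x => (key x).symm) n)
    (some a)
  rw [h] at this
  exact this.symm

/-- The machine that runs a program and then the machine `T` on the output of the program. -/
@[reducible] def comp [Fintype K] (p : StackProg K) (k₀ : K) : FinTM2 :=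
  letI := T.kFin
  letI := T.ΛFin
  letI := T.σFin
  { K := K ⊕ T.K
    k₀ := Sum.inl k₀
    k₁ := Sum.inr T.k₁
    Γ := stackAlphabet K T
    Λ := p.Label ⊕ T.Λ
    main := .inl p.entry
    σ := Option Bool × T.σ
    initialState := (none, T.initialState)
    Γk₀Fin := inferInstanceAs (Fintype Bool)
    m := fun
      | .inl l => code T e p .inl (.inr T.main) l
      | .inr l => liftStmt T .inr (T.m l) }

theorem initList_eq (T : FinTM2) (l : List (T.Γ T.k₀)) :
    initList T l = ⟨some T.main, T.initialState, Function.update (fun _ => []) T.k₀ l⟩ := by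
  unfold initList
  congr 1
  funext k
  by_cases h : k = T.k₀
  · subst h
    simp
  · simp [h]

theorem haltList_eq (T : FinTM2) (l : List (T.Γ T.k₁)) :
    haltList T l = ⟨none, T.initialState, Function.update (fun _ => []) T.k₁ l⟩ := by
  unfold haltList
  congr 1
  funext k
  by_cases h : k = T.k₁
  · subst h
    simp
  · simp [h]

theorem reachesIn_of_outputs {T : FinTM2} {l : List (T.Γ T.k₀)} {l' : List (T.Γ T.k₁)} {t : ℕ}
    (h : Nonempty (TM2OutputsInTime T l (some l') t)) :
    ReachesIn (TM2.step T.m) (initList T l) (haltList T l') t :=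
  h.elim fun h => ⟨h.steps, h.steps_le_m, h.evals_in_steps⟩

/-- The configuration in which the program exits is the lifted initial configuration of `T` on `o`,
so the two computations concatenate. The program must end with empty stacks because a halting
configuration allows only the output stack to be nonempty. -/
theorem outputs_comp [Fintype K] {p : StackProg K} {k₀ : K} {x o : List Bool} {t₁ t₂ : ℕ}
    (h : Exec p (Function.update (fun _ => []) k₀ x) [] (fun _ => []) o t₁)
    {l : List (T.Γ T.k₁)} (hT : Nonempty (TM2OutputsInTime T (o.map e) (some l) t₂)) :
    Nonempty (TM2OutputsInTime (comp T e p k₀) x (some l) (t₁ + t₂)) := by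
  have h₁ := h.reachesIn T e (comp T e p k₀).m .inl (.inr T.main) fun _ => rfl
  have h₂ := (reachesIn_of_outputs hT).lift T (m := (comp T e p k₀).m) (lab := .inr) fun _ => rfl
  have hi : progCfg T e (.inl p.entry) (Function.update (fun _ => []) k₀ x) [] =
      initList (comp T e p k₀) x := by
    rw [initList_eq, progCfg, ← update_joinStacks_inl]
    congr 2
    funext k
    rcases k with k | k
    · rfl
    · simp [joinStacks, inputStacks]
  have hf : liftCfg T (.inr : T.Λ → p.Label ⊕ T.Λ) (haltList T l) =
      haltList (comp T e p k₀) l := by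
    rw [haltList_eq, haltList_eq, liftCfg, ← update_joinStacks_inr]
    congr 2
    funext k
    rcases k with k | k <;> rfl
  have hmid : progCfg (K := K) T e (.inr T.main : p.Label ⊕ T.Λ) (fun _ => []) o =
      liftCfg T .inr (initList T (o.map e)) := by
    rw [initList_eq]
    rfl
  rw [hmid] at h₁
  obtain ⟨n, hn, h⟩ := h₁.trans h₂
  rw [hi, hf] at h
  exact ⟨⟨n, h⟩, hn⟩

end StackProg

/-! ### The reduction as a program -/

namespace ThreeCNF

open StackProg

/-- The stacks of the reduction: its input, three counters for the variables, a counter for the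
clauses, two counters for the variable of a literal, an auxiliary stack, and the encoded rules and
word in reverse order. -/
inductive Reg
  | input | vars | vars₂ | vars₃ | clause | lit | lit₂ | aux | rules | word
  deriving DecidableEq

instance : Fintype Reg where
  elems := {.input, .vars, .vars₂, .vars₃, .clause, .lit, .lit₂, .aux, .rules, .word}
  complete := by rintro ⟨⟩ <;> decide

/-- The contents of the stacks. -/
@[ext]
structure Store where
  input : List Bool
  vars : List Bool
  vars₂ : List Bool
  vars₃ : List Bool
  clause : List Bool
  lit : List Bool
  lit₂ : List Bool
  aux : List Bool
  rules : List Bool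
  word : List Bool

namespace Store

/-- The content of a given stack. -/
def get (S : Store) : Reg → List Bool
  | .input => S.input
  | .vars => S.vars
  | .vars₂ => S.vars₂
  | .vars₃ => S.vars₃
  | .clause => S.clause
  | .lit => S.lit
  | .lit₂ => S.lit₂
  | .aux => S.aux
  | .rules => S.rules
  | .word => S.word

/-- Replace the content of a stack. -/
def set (S : Store) : Reg → List Bool → Store
  | .input, l => { S with input := l }
  | .vars, l => { S with vars := l }
  | .vars₂, l => { S with vars₂ := l }
  | .vars₃, l => { S with vars₃ := l }
  | .clause, l => { S with clause := l }
  | .lit, l => { S with lit := l }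
  | .lit₂, l => { S with lit₂ := l }
  | .aux, l => { S with aux := l }
  | .rules, l => { S with rules := l }
  | .word, l => { S with word := l }

theorem update_get (S : Store) (k : Reg) (l : List Bool) :
    Function.update S.get k l = (S.set k l).get := by
  funext k'
  cases k <;> cases k' <;> rfl

end Store

/-- Execution of a program in terms of `Store`. -/
abbrev Runs (p : StackProg Reg) (S : Store) (o : List Bool) (S' : Store) (o' : List Bool)
    (t : ℕ) : Prop :=
  Exec p S.get o S'.get o' t

theorem runs_push (k : Reg) (bs : List Bool) (S : Store) (o : List Bool) :
    Runs (push k bs) S o (S.set k (bs.reverse ++ S.get k)) o (bs.length + 1) := by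
  rw [Runs, ← Store.update_get]
  exact .push ..

theorem runs_flush (k : Reg) (S : Store) (o : List Bool) :
    Runs (flush k) S o (S.set k []) ((S.get k).reverse ++ o) ((S.get k).length + 1) := by
  rw [Runs, ← Store.update_get]
  exact .flush ..

theorem runs_loop_push {k k' : Reg} (hk : k ≠ k') (d : ℕ) {S : Store} (j : ℕ) (l : List Bool)
    (hs : S.get k = List.replicate j true ++ l) (hl : l.head? ≠ some true) (o : List Bool) :
    Runs (loop k (push k' (List.replicate d true))) S o
      ((S.set k l.tail).set k' (List.replicate (d * j) true ++ S.get k')) o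
      (j * (d + 2) + 1) := by
  rw [Runs, ← Store.update_get, ← Store.update_get]
  exact exec_loop_push hk d hs hl o

theorem runs_loop_emit {k : Reg} (d : ℕ) {S : Store} (j : ℕ)
    (hs : S.get k = List.replicate j true) (o : List Bool) :
    Runs (loop k (emit (List.replicate d true))) S o (S.set k [])
      (List.replicate (d * j) true ++ o) (j * (d + 2) + 1) := by
  rw [Runs, ← Store.update_get]
  exact exec_loop_emit d hs o

theorem runs_copy {src dst : Reg} (h₁ : src ≠ .aux) (h₂ : src ≠ dst) (h₃ : .aux ≠ dst) (d : ℕ)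
    {S : Store} (j : ℕ) (hs : S.get src = List.replicate j true) (ha : S.aux = [])
    (o : List Bool) :
    Runs (copy src .aux dst d) S o (S.set dst (List.replicate (d * j) true ++ S.get dst)) o
      (j * (d + 7) + 2) := by
  rw [Runs, ← Store.update_get]
  exact exec_copy h₁ h₂ h₃ d hs ha o

theorem runs_loop_exit {k : Reg} {p : StackProg Reg} {S : Store} (o : List Bool)
    (h : (S.get k).head? ≠ some true) :
    Runs (loop k p) S o (S.set k (S.get k).tail) o 1 := by
  rw [Runs, ← Store.update_get]
  exact .loop_exit h

theorem runs_loop_step {k : Reg} {p : StackProg Reg} {S S₁ S₂ : Store} {o o₁ o₂ : List Bool}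
    {t₁ t₂ : ℕ} {l : List Bool} (hs : S.get k = true :: l) (h₁ : Runs p (S.set k l) o S₁ o₁ t₁)
    (h₂ : Runs (loop k p) S₁ o₁ S₂ o₂ t₂) : Runs (loop k p) S o S₂ o₂ (t₁ + t₂ + 1) := by
  rw [Runs, ← Store.update_get] at h₁
  exact .loop_step hs h₁ h₂

theorem Runs.congr {p : StackProg Reg} {S S' S'' : Store} {o o' o'' : List Bool} {t t' : ℕ}
    (h : Runs p S o S' o' t) (hs : S' = S'') (ho : o' = o'') (ht : t ≤ t') :
    Runs p S o S'' o'' t' :=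
  Exec.congr h (hs ▸ rfl) ho ht

/-- Read the number of variables. -/
def readVars : StackProg Reg :=
  loop .input (push .vars [true] ;; push .vars₂ [true] ;; push .vars₃ [true])

/-- Three copies are made because the choice rules, the final state and the number of states each
consume one. -/
theorem runs_readVars (n : ℕ) (x v₁ v₂ v₃ c l₁ l₂ a r w o : List Bool) :
    Runs readVars ⟨encodeUnary n ++ x, v₁, v₂, v₃, c, l₁, l₂, a, r, w⟩ o
      ⟨x, List.replicate n true ++ v₁, List.replicate n true ++ v₂, List.replicate n true ++ v₃,
        c, l₁, l₂, a, r, w⟩ o (7 * n + 1) := by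
  unfold readVars
  induction n generalizing v₁ v₂ v₃ with
  | zero => exact runs_loop_exit o (by simp [Store.get, encodeUnary])
  | succ n ih =>
    refine (runs_loop_step (l := encodeUnary n ++ x) rfl ((runs_push ..).seq
      ((runs_push ..).seq (runs_push ..))) (ih (true :: v₁) (true :: v₂) (true :: v₃))).congr
      ?_ rfl (by simp only [List.length_singleton]; omega)
    ext1 <;> simp [List.replicate_succ']

/-- Write the number of the state of a literal whose variable is stored in a counter. -/
def writeState (k : Reg) (bs : List Bool) : StackProg Reg :=
  loop k (push .rules (List.replicate 3 true)) ;; push .rules (bs ++ [false])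

/-- Write the rule of a literal. -/
def writeLoop (bs : List Bool) : StackProg Reg :=
  push .rules [true] ;; writeState .lit bs ;; push .rules [true] ;; copy .clause .aux .rules 1 ;;
    push .rules [false, false] ;; writeState .lit₂ bs

/-- Read a literal and write its rule. -/
def readLit : StackProg Reg :=
  loop .input (push .lit [true] ;; push .lit₂ [true]) ;;
    ite .input (writeLoop [true]) (writeLoop [true, true])

/-- The encoding of the rule of a literal. -/
def loopBits (j k : ℕ) (b : Bool) : List Bool :=
  true :: (encodeUnary (litIndex k b) ++ (true :: encodeUnary j ++ [false]) ++
    encodeUnary (litIndex k b))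

theorem runs_readLitIndex (k : ℕ) (x v₁ v₂ v₃ c l₁ l₂ a r w o : List Bool) :
    Runs (loop .input (push .lit [true] ;; push .lit₂ [true]))
      ⟨encodeUnary k ++ x, v₁, v₂, v₃, c, l₁, l₂, a, r, w⟩ o
      ⟨x, v₁, v₂, v₃, c, List.replicate k true ++ l₁, List.replicate k true ++ l₂, a, r, w⟩ o
      (5 * k + 1) := by
  induction k generalizing l₁ l₂ with
  | zero => exact runs_loop_exit o (by simp [Store.get, encodeUnary])
  | succ k ih =>
    refine (runs_loop_step (l := encodeUnary k ++ x) rfl ((runs_push ..).seq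
      (runs_push ..)) (ih (true :: l₁) (true :: l₂))).congr
      ?_ rfl (by simp only [List.length_singleton]; omega)
    ext1 <;> simp [List.replicate_succ']

theorem runs_writeLoop (j k d : ℕ) (x v₁ v₂ v₃ r w o : List Bool) :
    Runs (writeLoop (List.replicate d true)) ⟨x, v₁, v₂, v₃, List.replicate j true,
        List.replicate k true, List.replicate k true, [], r, w⟩ o
      ⟨x, v₁, v₂, v₃, List.replicate j true, [], [], [],
        (true :: (encodeUnary (3 * k + d) ++ (true :: encodeUnary j ++ [false]) ++
          encodeUnary (3 * k + d))).reverse ++ r, w⟩ o (10 * k + 8 * j + 2 * d + 15) := by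
  refine Runs.congr ((runs_push ..).seq (((runs_loop_push (by decide) 3 k []
    (List.append_nil _).symm (by simp) _).seq (runs_push ..)).seq ((runs_push ..).seq
    ((runs_copy (by decide) (by decide) (by decide) 1 j rfl rfl _).seq ((runs_push ..).seq
    ((runs_loop_push (by decide) 3 k [] (List.append_nil _).symm (by simp) _).seq
    (runs_push ..))))))) ?_ rfl ?_
  · ext1 <;> simp [Store.set, Store.get, encodeUnary, List.replicate_add,
      -List.replicate_append_replicate]
  · simp only [List.length_append, List.length_replicate, List.length_cons]
    simp only [List.length_nil]
    omega

/-- The sign follows the index in the input, so the index is stored first, twice since a loop names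
its state twice. The sign then selects the offset 1 or 2 of `litIndex`. -/
theorem runs_readLit (j k : ℕ) (b : Bool) (x v₁ v₂ v₃ r w o : List Bool) :
    Runs readLit ⟨encodeUnary k ++ b :: x, v₁, v₂, v₃, List.replicate j true, [], [], [], r, w⟩ o
      ⟨x, v₁, v₂, v₃, List.replicate j true, [], [], [], (loopBits j k b).reverse ++ r, w⟩ o
      (15 * k + 8 * j + 21) := by
  have h₁ := runs_readLitIndex k (b :: x) v₁ v₂ v₃ (List.replicate j true) [] [] [] r w o
  rw [List.append_nil] at h₁
  cases b with
  | false =>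
    have h₂ := runs_writeLoop j k 2 x v₁ v₂ v₃ r w o
    have h₃ := Exec.ite_false (k := Reg.input) (p := writeLoop [true]) (q := writeLoop [true, true])
      (s := Store.get ⟨false :: x, v₁, v₂, v₃, List.replicate j true, List.replicate k true,
        List.replicate k true, [], r, w⟩) rfl (by rw [Store.update_get]; exact h₂)
    exact (h₁.seq h₃).congr rfl rfl (by omega)
  | true =>
    have h₂ := runs_writeLoop j k 1 x v₁ v₂ v₃ r w o
    have h₃ := Exec.ite_true (k := Reg.input) (p := writeLoop [true]) (q := writeLoop [true, true])
      (s := Store.get ⟨true :: x, v₁, v₂, v₃, List.replicate j true, List.replicate k true,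
        List.replicate k true, [], r, w⟩) rfl (by rw [Store.update_get]; exact h₂)
    exact (h₁.seq h₃).congr rfl rfl (by omega)

/-- Read a clause, write its rules and a letter of the word. -/
def readClause : StackProg Reg :=
  readLit ;; readLit ;; readLit ;; push .word [true] ;; copy .clause .aux .word 1 ;;
    push .word [false] ;; push .clause [true]

/-- The encoding of a clause. -/
def clauseBits {n : ℕ} (c : SatLiteral n × SatLiteral n × SatLiteral n) : List Bool :=
  SatLiteral.encode c.1 ++ SatLiteral.encode c.2.1 ++ SatLiteral.encode c.2.2

/-- The encoding of the rules of a clause. -/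
def clauseRuleBits {n : ℕ} (c : SatLiteral n × SatLiteral n × SatLiteral n) (j : ℕ) : List Bool :=
  (lits c).flatMap fun l => loopBits j l.1 l.2

theorem runs_readClause {n B j : ℕ} (hn : n ≤ B) (hj : j ≤ B)
    (c : SatLiteral n × SatLiteral n × SatLiteral n) (x v₁ v₂ v₃ r w o : List Bool) :
    Runs readClause ⟨clauseBits c ++ x, v₁, v₂, v₃, List.replicate j true, [], [], [], r, w⟩ o
      ⟨x, v₁, v₂, v₃, List.replicate (j + 1) true, [], [], [], (clauseRuleBits c j).reverse ++ r,
        (true :: encodeUnary j).reverse ++ w⟩ o (77 * B + 71) := by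
  obtain ⟨⟨k₁, b₁⟩, ⟨k₂, b₂⟩, ⟨k₃, b₃⟩⟩ := c
  have hx : clauseBits ((k₁, b₁), (k₂, b₂), (k₃, b₃)) ++ x = encodeUnary k₁ ++ b₁ ::
      (encodeUnary k₂ ++ b₂ :: (encodeUnary k₃ ++ b₃ :: x)) := by
    simp [clauseBits, SatLiteral.encode]
  rw [hx]
  refine Runs.congr ((runs_readLit ..).seq ((runs_readLit ..).seq ((runs_readLit ..).seq
    ((runs_push ..).seq ((runs_copy (by decide) (by decide) (by decide) 1 j rfl rfl _).seq
    ((runs_push ..).seq (runs_push ..))))))) ?_ rfl ?_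
  · ext1 <;> simp [Store.set, Store.get, encodeUnary, clauseRuleBits, lits, List.replicate_succ]
  · have := k₁.2
    have := k₂.2
    have := k₃.2
    simp only [List.length_singleton]
    omega

/-- Read all clauses. -/
def readClauses : StackProg Reg :=
  loop .input readClause

/-- The clause counter serves both as the letter of the current clause and, at the end, as the size
of the alphabet. -/
theorem runs_readClauses {n B : ℕ} (hn : n ≤ B)
    (cs : List (SatLiteral n × SatLiteral n × SatLiteral n)) (j : ℕ) (hj : j + cs.length ≤ B)
    (v₁ v₂ v₃ r w o : List Bool) :
    Runs readClauses
      ⟨encodeBlocks clauseBits cs, v₁, v₂, v₃, List.replicate j true, [], [], [], r, w⟩ o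
      ⟨[], v₁, v₂, v₃, List.replicate (j + cs.length) true, [], [], [],
        ((cs.zipIdx j).flatMap fun c => clauseRuleBits c.1 c.2).reverse ++ r,
        ((List.range' j cs.length).flatMap fun j => true :: encodeUnary j).reverse ++ w⟩ o
      (cs.length * (77 * B + 72) + 1) := by
  induction cs generalizing j r w with
  | nil =>
    refine (runs_loop_exit o (by simp [Store.get, encodeBlocks])).congr ?_ rfl (by simp)
    ext1 <;> simp [Store.set, Store.get, encodeBlocks]
  | cons c cs ih =>
    rw [List.length_cons] at hj
    refine (runs_loop_step (l := clauseBits c ++ encodeBlocks clauseBits cs)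
      (by simp [Store.get, encodeBlocks]) (runs_readClause hn (by omega) c ..)
      (ih (j + 1) (by omega) _ _)).congr ?_ rfl ?_
    · ext1 <;> simp [List.zipIdx_cons, List.range'_succ, Nat.add_comm, Nat.add_left_comm]
    · rw [List.length_cons]
      ring_nf
      omega

/-- Write a rule with the empty label. -/
def writeStep (d d' : ℕ) : StackProg Reg :=
  push .rules [true] ;; copy .vars .aux .rules 3 ;;
    push .rules (List.replicate d true ++ [false, false]) ;; copy .vars .aux .rules 3 ;;
    push .rules (List.replicate d' true ++ [false])

/-- The encoding of a rule with the empty label. -/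
def stepBits (p q : ℕ) : List Bool :=
  true :: (encodeUnary p ++ [false] ++ encodeUnary q)

theorem runs_writeStep (d d' i : ℕ) (hd : d ≤ 3) (hd' : d' ≤ 3)
    (x v₂ v₃ c l₁ l₂ r w o : List Bool) :
    Runs (writeStep d d') ⟨x, List.replicate i true, v₂, v₃, c, l₁, l₂, [], r, w⟩ o
      ⟨x, List.replicate i true, v₂, v₃, c, l₁, l₂, [],
        (stepBits (3 * i + d) (3 * i + d')).reverse ++ r, w⟩ o (20 * i + 17) := by
  refine Runs.congr ((runs_push ..).seq
    ((runs_copy (by decide) (by decide) (by decide) 3 i rfl rfl _).seq ((runs_push ..).seq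
    ((runs_copy (by decide) (by decide) (by decide) 3 i rfl rfl _).seq (runs_push ..))))) ?_ rfl ?_
  · ext1 <;> simp [Store.set, Store.get, encodeUnary, stepBits, List.replicate_add,
      -List.replicate_append_replicate]
  · simp only [List.length_append, List.length_replicate, List.length_cons]
    simp only [List.length_nil]
    omega

/-- Write the rules that choose the values of the variables. -/
def writeChoices : StackProg Reg :=
  loop .vars (writeStep 0 1 ;; writeStep 1 3 ;; writeStep 0 2 ;; writeStep 2 3)

/-- The encoding of the rules that choose a value of a variable. -/
def choiceBits (i : ℕ) : List Bool :=
  stepBits (3 * i) (3 * i + 1) ++ stepBits (3 * i + 1) (3 * i + 3) ++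
    stepBits (3 * i) (3 * i + 2) ++ stepBits (3 * i + 2) (3 * i + 3)

/-- What remains of the counter after each pop is the index of the variable treated, so the indices
descend; hence the `reverse` in `jfaRules`. -/
theorem runs_writeChoices {B : ℕ} (n : ℕ) (hn : n ≤ B) (x v₂ v₃ c l₁ l₂ r w o : List Bool) :
    Runs writeChoices ⟨x, List.replicate n true, v₂, v₃, c, l₁, l₂, [], r, w⟩ o
      ⟨x, [], v₂, v₃, c, l₁, l₂, [], ((List.range n).reverse.flatMap choiceBits).reverse ++ r, w⟩ o
      (n * (80 * B + 69) + 1) := by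
  induction n generalizing r with
  | zero => exact (runs_loop_exit o (by simp [Store.get])).congr rfl rfl (by simp)
  | succ n ih =>
    refine (runs_loop_step (l := List.replicate n true) rfl
      ((runs_writeStep 0 1 n (by omega) (by omega) ..).seq
      ((runs_writeStep 1 3 n (by omega) (by omega) ..).seq
      ((runs_writeStep 0 2 n (by omega) (by omega) ..).seq
      (runs_writeStep 2 3 n (by omega) (by omega) ..))))
      (ih (by omega) _)).congr ?_ rfl ?_
    · ext1 <;> simp [List.range_succ, choiceBits]
    · ring_nf
      omega

/-- Read the formula. -/
def readFormula : StackProg Reg :=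
  readVars ;; readClauses ;; writeChoices

/-- Write the instance of the universal word problem, from its end to its beginning. -/
def writeInstance : StackProg Reg :=
  emit [false] ;; flush .word ;; emit [false] ;; flush .rules ;; emit [false, false] ;;
    loop .vars₂ (emit (List.replicate 3 true)) ;; emit [false, false, true] ;;
    loop .clause (emit (List.replicate 1 true)) ;; emit [true, false] ;;
    loop .vars₃ (emit (List.replicate 3 true))

/-- The reduction from 3SAT to the universal word problem for JFA. -/
def reduction : StackProg Reg :=
  readFormula ;; writeInstance

end ThreeCNF

/-! ### Correctness and running time of the reduction program -/

namespace ThreeCNF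

open StackProg

/-- The encodings of the rules of `φ.toJFA`. -/
def rulesBits (φ : ThreeCNF) : List Bool :=
  (φ.clauses.zipIdx.flatMap fun c => clauseRuleBits c.1 c.2) ++
    (List.range φ.numVars).reverse.flatMap choiceBits

/-- The encodings of the letters of the word of `φ.toJFA`. -/
def wordBits (φ : ThreeCNF) : List Bool :=
  (List.range φ.clauses.length).flatMap fun j => true :: encodeUnary j

theorem runs_readFormula (φ : ThreeCNF) {B : ℕ} (hn : φ.numVars ≤ B)
    (hm : φ.clauses.length ≤ B) :
    Runs readFormula ⟨φ.encode, [], [], [], [], [], [], [], [], []⟩ []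
      ⟨[], [], List.replicate φ.numVars true, List.replicate φ.numVars true,
        List.replicate φ.clauses.length true, [], [], [], φ.rulesBits.reverse, φ.wordBits.reverse⟩
      [] (157 * B ^ 2 + 148 * B + 3) := by
  refine Runs.congr ((runs_readVars φ.numVars (encodeBlocks clauseBits φ.clauses) ..).seq
    (Exec.seq (by
      simp only [List.append_nil]
      exact runs_readClauses hn φ.clauses 0 (by omega) ..)
    (runs_writeChoices φ.numVars hn ..))) ?_ rfl ?_
  · ext1 <;> simp [rulesBits, wordBits, List.range_eq_range']
  · nlinarith

/-- Output grows at the front, so the fields are written last to first, and flushing undoes the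
reversal of the accumulated rules and word. The `true` in the last emitted constant is the + 1 in
the number of states. -/
theorem runs_writeInstance (n m : ℕ) (r w : List Bool) :
    Runs writeInstance ⟨[], [], List.replicate n true, List.replicate n true,
        List.replicate m true, [], [], [], r.reverse, w.reverse⟩ []
      ⟨[], [], [], [], [], [], [], [], [], []⟩
      (encodeUnary (3 * n + 1) ++ encodeUnary m ++ encodeUnary 0 ++
        (true :: encodeUnary (3 * n) ++ [false]) ++ (r ++ [false]) ++ (w ++ [false]))
      (r.length + w.length + 10 * n + 3 * m + 21) := by
  refine Runs.congr ((Exec.emit ..).seq ((runs_flush ..).seq ((Exec.emit ..).seq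
    ((runs_flush ..).seq ((Exec.emit ..).seq ((runs_loop_emit 3 n rfl _).seq
    ((Exec.emit ..).seq ((runs_loop_emit 1 m rfl _).seq ((Exec.emit ..).seq
    (runs_loop_emit 3 n rfl _)))))))))) ?_ ?_ ?_
  · rfl
  · simp [Store.set, Store.get, encodeUnary, List.replicate_add, -List.replicate_append_replicate]
  · simp only [Store.set, Store.get, List.length_reverse, List.length_cons, List.length_nil]
    omega

theorem zipIdx_flatMap_eq {α β : Type} (l : List α) (g : α → ℕ → List β) :
    (l.zipIdx.flatMap fun x => g x.1 x.2) =
      (List.finRange l.length).flatMap fun j => g (l.get j) j := by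
  have h : l.zipIdx = (List.finRange l.length).map fun j => (l.get j, (j : ℕ)) :=
    List.ext_getElem (by simp) (by simp)
  rw [h, List.flatMap_map]

theorem range_flatMap_eq {β : Type} (m : ℕ) (g : ℕ → List β) :
    (List.range m).flatMap g = (List.finRange m).flatMap fun j : Fin m => g j := by
  rw [← List.map_coe_finRange_eq_range, List.flatMap_map]

/-- This identifies the program's output format, with indices in `ℕ`, with the encoding of the
instance, with indices in `Fin`. -/
theorem encode_toJFA (φ : ThreeCNF) :
    φ.toJFA.encode = encodeUnary (3 * φ.numVars + 1) ++ encodeUnary φ.clauses.length ++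
      encodeUnary 0 ++ (true :: encodeUnary (3 * φ.numVars) ++ [false]) ++
      (φ.rulesBits ++ [false]) ++ (φ.wordBits ++ [false]) := by
  have hf : encodeBlocks (fun q : Fin (3 * φ.numVars + 1) => encodeUnary q)
      [hub φ.numVars le_rfl] = true :: encodeUnary (3 * φ.numVars) ++ [false] := by
    simp [encodeBlocks, hub]
  have hr : encodeBlocks (fun r : Fin (3 * φ.numVars + 1) × Option (Fin φ.clauses.length) ×
      Fin (3 * φ.numVars + 1) => encodeUnary r.1 ++
      encodeBlocks (fun a => encodeUnary a) r.2.1.toList ++ encodeUnary r.2.2) φ.jfaRules =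
      φ.rulesBits ++ [false] := by
    rw [encodeBlocks, jfaRules, rulesBits, List.flatMap_append, List.flatMap_assoc,
      List.flatMap_assoc, zipIdx_flatMap_eq, ← List.map_coe_finRange_eq_range,
      ← List.map_reverse, List.flatMap_map]
    congr 2
    · simp [loopRules, encodeBlocks, litState, litIndex, clauseRuleBits, loopBits, lits]
    · simp [choiceRules, choiceBits, stepBits, encodeBlocks, hub, litState, litIndex, Nat.mul_succ]
  have hw : encodeBlocks (fun a => encodeUnary a) (List.finRange φ.clauses.length) =
      φ.wordBits ++ [false] := by
    rw [encodeBlocks, wordBits, range_flatMap_eq]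
    simp [List.flatMap_assoc]
  rw [← hf, ← hr, ← hw]
  rfl

theorem numVars_le_length_encode (φ : ThreeCNF) : φ.numVars ≤ φ.encode.length := by
  simp [encode, encodeUnary]

theorem length_clauses_le_length_encode (φ : ThreeCNF) :
    φ.clauses.length ≤ φ.encode.length := by
  have h : ∀ {α : Type} (enc : α → List Bool) (l : List α),
      l.length ≤ (encodeBlocks enc l).length := by
    intro α enc l
    induction l with
    | nil => simp
    | cons a l ih =>
      simp only [encodeBlocks, List.flatMap_cons, List.length_append, List.length_cons] at ih ⊢
      omega
  rw [encode, List.length_append]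
  exact (h _ _).trans (Nat.le_add_left _ _)

theorem exec_reduction (φ : ThreeCNF) :
    Exec reduction (Function.update (fun _ => []) .input φ.encode) [] (fun _ => [])
      φ.toJFA.encode (1000 * (φ.encode.length + 1) ^ 2) := by
  have hn := φ.numVars_le_length_encode
  have hm := φ.length_clauses_le_length_encode
  have h₁ := φ.runs_readFormula hn hm
  have h₂ := runs_writeInstance φ.numVars φ.clauses.length φ.rulesBits φ.wordBits
  -- Flushing costs the lengths of these two stacks, each at most the reading time; the total stays
  -- quadratic, and 1000 is a generous constant.
  have hr := h₁.length_le .rules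
  have hw := h₁.length_le .word
  simp only [Store.get, List.length_reverse, List.length_nil] at hr hw
  rw [← encode_toJFA] at h₂
  have hs : ∀ x, Function.update (fun _ => []) Reg.input x =
      (⟨x, [], [], [], [], [], [], [], [], []⟩ : Store).get := by
    intro x
    funext k
    cases k <;> rfl
  rw [hs]
  refine (h₁.seq h₂).congr ?_ rfl (by nlinarith)
  funext k
  cases k <;> rfl

end ThreeCNF

/-! ### Transfer of time bounds -/

theorem Polynomial.eval_le_eval_of_le (p : Polynomial ℕ) {a b : ℕ} (h : a ≤ b) :
    p.eval a ≤ p.eval b := by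
  rw [Polynomial.eval_eq_sum_range, Polynomial.eval_eq_sum_range]
  gcongr

/-- A reduction computed by a program in polynomial time, with a linear bound on the parameter,
transfers decidability in subexponential time. -/
theorem DecidableInSubexpTime.of_reduction {α β : Type} {encα : α → List Bool} {κα : α → ℕ}
    {Pα : α → Prop} {encβ : β → List Bool} {κβ : β → ℕ} {Pβ : β → Prop} {K : Type} [DecidableEq K]
    [Fintype K] (prog : StackProg K) (k₀ : K) (g : α → β) (q : Polynomial ℕ) (a b : ℕ) (ha : 0 < a)
    (hexec : ∀ x, prog.Exec (Function.update (fun _ => []) k₀ (encα x)) [] (fun _ => [])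
      (encβ (g x)) (q.eval (encα x).length))
    (hκ : ∀ x, κβ (g x) = a * κα x + b) (hP : ∀ x, Pβ (g x) ↔ Pα x)
    (h : DecidableInSubexpTime encβ κβ Pβ) : DecidableInSubexpTime encα κα Pα := by
  classical
  obtain ⟨T, f, p, hf, hT⟩ := h
  refine ⟨⟨StackProg.comp T.tm T.inputAlphabet.symm prog k₀, Equiv.refl Bool, T.outputAlphabet⟩,
    -- The absolute value makes the exponential factor at least 1, so it also covers the time `q` of
    -- the reduction. The composition appears because the output is no longer than that time.
    fun n => |f (a * n + b)|, q + p.comp q, ?_, fun x => ?_⟩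
  · have hlin : Filter.Tendsto (fun n : ℕ => a * n + b) Filter.atTop Filter.atTop :=
      Filter.tendsto_atTop_mono (fun n => le_add_right (Nat.le_mul_of_pos_left n ha)) Filter.tendsto_id
    refine ((hf.comp_tendsto hlin).trans_isBigO ?_).abs_left
    -- For n ≥ 1, a n + b ≤ (a + b) n.
    refine Asymptotics.IsBigO.of_bound (a + b : ℝ) ?_
    filter_upwards [Filter.eventually_ge_atTop 1] with n hn
    have hn : (1 : ℝ) ≤ n := by exact_mod_cast hn
    simp only [Function.comp_apply, Nat.cast_add, Nat.cast_mul, Real.norm_eq_abs]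
    rw [abs_of_nonneg (by positivity), abs_of_nonneg (by positivity)]
    nlinarith [(Nat.cast_nonneg b : (0 : ℝ) ≤ b)]
  · obtain ⟨t, ht, hout⟩ := hT (g x)
    refine ⟨q.eval (encα x).length + t, ?_, ?_⟩
    · have hlen : (encβ (g x)).length ≤ q.eval (encα x).length := by
        simpa using (hexec x).length_output_le
      have hp := p.eval_le_eval_of_le hlen
      rw [hκ] at ht
      have h₁ : (1 : ℝ) ≤ 2 ^ |f (a * κα x + b)| :=
        Real.one_le_rpow one_le_two (abs_nonneg _)
      have h₂ : (2 : ℝ) ^ f (a * κα x + b) ≤ 2 ^ |f (a * κα x + b)| :=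
        Real.rpow_le_rpow_of_exponent_le one_le_two (le_abs_self _)
      rw [Polynomial.eval_add, Polynomial.eval_comp, Nat.cast_add, Nat.cast_add, mul_add]
      refine add_le_add (le_mul_of_one_le_left (Nat.cast_nonneg _) h₁) (ht.trans ?_)
      gcongr
    · have hdec : decide (Pβ (g x)) = decide (Pα x) := decide_eq_decide.2 (hP x)
      rw [hdec] at hout
      have := StackProg.outputs_comp T.tm T.inputAlphabet.symm (hexec x) hout
      simpa using this

theorem mainTheorem7 (hETH : ExponentialTimeHypothesis) :
    ¬ DecidableInSubexpTime JFAWordInstance.encode JFAWordInstance.numStates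
        JFAWordInstance.Accepts := by
  refine fun h => hETH (h.of_reduction ThreeCNF.reduction .input ThreeCNF.toJFA
    (Polynomial.C 1000 * (Polynomial.X + 1) ^ 2) 3 1 (by norm_num) (fun φ => ?_) (fun _ => rfl)
    fun _ => ThreeCNF.accepts_toJFA_iff)
  simpa using φ.exec_reduction
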